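/- Let $(\Omega,\mathcal F,\mathbb P)$ be an atomless probability space and let $L^0$ be the set of all real-valued random variables on it. The expectation $\mathbb E[X]=\mathbb E[X_+]-\mathbb E[X_-]\in[-\infty,\infty]$ is called well-defined if $\mathbb E[X_+]<\infty$ or $\mathbb E[X_-]<\infty$, where $x_+=\max\{x,0\}$ and $x_-=\max\{-x,0\}$. For $X,Y\in L^0$ write $X\le_{\rm cx}Y$ if $\mathbb E[u(X)]\le\mathbb E[u(Y)]$ for every convex function $u:\mathbb R\to\mathbb R$ such that both expectations are well-defined (possibly infinite). A pair $(X,Y)$ is comonotonic if, almost surely, $X=f(V)$ and $Y=g(V)$ for some random variable $V\in L^0$ and some (weakly) increasing functions $f,g:\mathbb R\to\mathbb R$. A comonotonic version of $(Z,W)$ is a comonotonic pair $(Z^{\rm co},W^{\rm co})$ of random variables in $L^0$ such that $Z^{\rm co}$ has the same distribution as $Z$ and $W^{\rm co}$ has the same distribution as $W$. Theorem. Let $X,Y,Z,W\in L^0$. If $X\le_{\rm cx}Z$ and $Y\le_{\rm cx}W$, then $$X+Y\le_{\rm cx}Z^{\rm co}+W^{\rm co}$$ for every comonotonic version $(Z^{\rm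 co},W^{\rm co})$ of $(Z,W)$. -/

import Mathlib

open MeasureTheory ProbabilityTheory

namespace ConvexOrder

/-- A measure is atomless if every measurable set of positive measure has a measurable subset of
strictly smaller positive measure. -/
def Atomless {Ω : Type*} [MeasurableSpace Ω] (P : Measure Ω) : Prop :=
  ∀ A : Set Ω, MeasurableSet A → 0 < P A →
    ∃ B : Set Ω, B ⊆ A ∧ MeasurableSet B ∧ 0 < P B ∧ P B < P A

/-- The expectation of `X` is well-defined: `E[X₊] < ∞` or `E[X₋] < ∞`. -/
def ExpectationWellDefined {Ω : Type*} [MeasurableSpace Ω] (P : Measure Ω) (X : Ω → ℝ) : Prop :=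
  ∫⁻ ω, ENNReal.ofReal (max (X ω) 0) ∂P < ⊤ ∨ ∫⁻ ω, ENNReal.ofReal (max (-X ω) 0) ∂P < ⊤

/-- The expectation `E[X] = E[X₊] - E[X₋]` with values in `[-∞, ∞]`. It is only meaningful when
it is well-defined in the sense of `ExpectationWellDefined`. -/
noncomputable def expectation {Ω : Type*} [MeasurableSpace Ω] (P : Measure Ω) (X : Ω → ℝ) :
    EReal :=
  ((∫⁻ ω, ENNReal.ofReal (max (X ω) 0) ∂P : ENNReal) : EReal) -
    ((∫⁻ ω, ENNReal.ofReal (max (-X ω) 0) ∂P : ENNReal) : EReal)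

/-- Convex order `X ≤_cx Y`: `E[u(X)] ≤ E[u(Y)]` for all convex `u : ℝ → ℝ` such that both
expectations are well-defined (possibly infinite). -/
def ConvexLE {Ω : Type*} [MeasurableSpace Ω] (P : Measure Ω) (X Y : Ω → ℝ) : Prop :=
  ∀ u : ℝ → ℝ, ConvexOn ℝ Set.univ u →
    ExpectationWellDefined P (fun ω => u (X ω)) →
    ExpectationWellDefined P (fun ω => u (Y ω)) →
    expectation P (fun ω => u (X ω)) ≤ expectation P (fun ω => u (Y ω))

/-- The pair `(X, Y)` is comonotonic: almost surely `X = f(V)` and `Y = g(V)` for some random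
variable `V` and (weakly) increasing functions `f`, `g`. -/
def Comonotonic {Ω : Type*} [MeasurableSpace Ω] (P : Measure Ω) (X Y : Ω → ℝ) : Prop :=
  ∃ (V : Ω → ℝ) (f g : ℝ → ℝ), Measurable V ∧ Monotone f ∧ Monotone g ∧
    (∀ᵐ ω ∂P, X ω = f (V ω)) ∧ (∀ᵐ ω ∂P, Y ω = g (V ω))

/-- `(X', Y')` is a comonotonic version of `(X, Y)`: it is a comonotonic pair of random variables
with the same marginal distributions. -/
def IsComonotonicVersion {Ω : Type*} [MeasurableSpace Ω] (P : Measure Ω)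
    (X' Y' X Y : Ω → ℝ) : Prop :=
  Measurable X' ∧ Measurable Y' ∧ Comonotonic P X' Y' ∧
    IdentDistrib X' X P P ∧ IdentDistrib Y' Y P P

end ConvexOrder

/-! Stop-loss functions `(x - k)₊` carry the argument. For every `a`, subadditivity gives `(X + Y -
k)₊ ≤ (X - a)₊ + (Y - (k - a))₊`. For a comonotonic pair some `a` turns this into an equality,
because both summands cross their thresholds together (`exists_retention_split`). Taking
expectations with this `a` compares the stop-loss transforms of the two sums (`stopLoss_add_le`).

No integrability is assumed, so means may be infinite or undefined and the transforms of `-X` are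
treated separately. Together, both families control all nonnegative convex tests, which are mixtures
of them around a minimum (`nonnegConvexLE_of_stopLoss`). A general convex `u` is reached through the
truncations `max u (-n)` (`NonnegConvexLE.lintegral_add_le`). -/

open Set

namespace ConvexOrder

variable {Ω : Type*} [MeasurableSpace Ω] {P : Measure Ω}

/-! ### Reduction to nonnegative convex test functions -/

/-- The order generated by nonnegative convex test functions. -/
def NonnegConvexLE (P : Measure Ω) (X Y : Ω → ℝ) : Prop :=
  ∀ u : ℝ → ℝ, ConvexOn ℝ univ u → (∀ x, 0 ≤ u x) →
    ∫⁻ ω, ENNReal.ofReal (u (X ω)) ∂P ≤ ∫⁻ ω, ENNReal.ofReal (u (Y ω)) ∂P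

lemma continuous_of_convexOn_univ {u : ℝ → ℝ} (hu : ConvexOn ℝ univ u) : Continuous u :=
  continuousOn_univ.1 (hu.continuousOn isOpen_univ)

lemma convexOn_max_zero {u : ℝ → ℝ} (hu : ConvexOn ℝ univ u) :
    ConvexOn ℝ univ (fun x => max (u x) 0) :=
  hu.sup (convexOn_const 0 convex_univ)

lemma convexOn_max_sub_zero (k : ℝ) : ConvexOn ℝ univ (fun x : ℝ => max (x - k) 0) :=
  convexOn_max_zero ((convexOn_id convex_univ).sub (concaveOn_const k convex_univ))

lemma convexOn_comp_neg {u : ℝ → ℝ} (hu : ConvexOn ℝ univ u) :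
    ConvexOn ℝ univ (fun x => u (-x)) :=
  hu.comp_linearMap (-LinearMap.id : ℝ →ₗ[ℝ] ℝ)

/-- A nonnegative test has vanishing negative part, so its expectations are always well-defined. -/
lemma ConvexLE.nonnegConvexLE {X Y : Ω → ℝ} (h : ConvexLE P X Y) : NonnegConvexLE P X Y := by
  intro u hu h0
  have hneg : ∀ V : Ω → ℝ, ∫⁻ ω, ENNReal.ofReal (max (-u (V ω)) 0) ∂P = 0 := by
    intro V
    simp [h0]
  have key := h u hu (Or.inr (by rw [hneg]; simp)) (Or.inr (by rw [hneg]; simp))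
  simpa [expectation, hneg, h0] using key

lemma NonnegConvexLE.neg {X Y : Ω → ℝ} (h : NonnegConvexLE P X Y) :
    NonnegConvexLE P (fun ω => -X ω) (fun ω => -Y ω) :=
  fun _ hu h0 => h _ (convexOn_comp_neg hu) (fun x => h0 (-x))

lemma NonnegConvexLE.stopLoss {X Y : Ω → ℝ} (h : NonnegConvexLE P X Y) (k : ℝ) :
    ∫⁻ ω, ENNReal.ofReal (X ω - k) ∂P ≤ ∫⁻ ω, ENNReal.ofReal (Y ω - k) ∂P := by
  simpa using h _ (convexOn_max_sub_zero k) (fun x => le_max_right _ _)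

/-- Both `a₊ - min a₋ N` and `(a + N)₊ - N` equal the truncation `max a (-N)`. -/
lemma ofReal_add_ofReal_min (a N : ℝ) (hN : 0 ≤ N) :
    ENNReal.ofReal (max (a + N) 0) + ENNReal.ofReal (min (max (-a) 0) N) =
      ENNReal.ofReal (max a 0) + ENNReal.ofReal N := by
  rw [← ENNReal.ofReal_add (le_max_right _ _) (le_min (le_max_right _ _) hN),
    ← ENNReal.ofReal_add (le_max_right _ _) hN]
  congr 1
  grind

lemma iSup_ofReal_min (a : ℝ) : ⨆ n : ℕ, ENNReal.ofReal (min a n) = ENNReal.ofReal a := by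
  refine le_antisymm (iSup_le fun n => ENNReal.ofReal_le_ofReal (min_le_left _ _)) ?_
  obtain ⟨n, hn⟩ := exists_nat_ge a
  exact le_iSup_of_le n (by rw [min_eq_left hn])

/-- The comparison of expectations, written without subtraction. -/
lemma NonnegConvexLE.lintegral_add_le [IsProbabilityMeasure P] {S T : Ω → ℝ}
    (hS : Measurable S) (hT : Measurable T) (h : NonnegConvexLE P S T) {u : ℝ → ℝ}
    (hu : ConvexOn ℝ univ u) :
    ∫⁻ ω, ENNReal.ofReal (max (u (S ω)) 0) ∂P + ∫⁻ ω, ENNReal.ofReal (max (-u (T ω)) 0) ∂P ≤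
      ∫⁻ ω, ENNReal.ofReal (max (u (T ω)) 0) ∂P +
        ∫⁻ ω, ENNReal.ofReal (max (-u (S ω)) 0) ∂P := by
  have hum : Measurable u := (continuous_of_convexOn_univ hu).measurable
  have split : ∀ V : Ω → ℝ, Measurable V → ∀ n : ℕ,
      ∫⁻ ω, ENNReal.ofReal (max (u (V ω) + n) 0) ∂P +
        ∫⁻ ω, ENNReal.ofReal (min (max (-u (V ω)) 0) n) ∂P =
      ∫⁻ ω, ENNReal.ofReal (max (u (V ω)) 0) ∂P + n := by
    intro V hV n
    rw [← lintegral_add_left (by fun_prop)]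
    simp_rw [ofReal_add_ofReal_min _ _ n.cast_nonneg]
    rw [lintegral_add_right _ measurable_const]
    simp
  have hsup : ∫⁻ ω, ENNReal.ofReal (max (-u (T ω)) 0) ∂P =
      ⨆ n : ℕ, ∫⁻ ω, ENNReal.ofReal (min (max (-u (T ω)) 0) n) ∂P := by
    rw [← lintegral_iSup (fun n => by fun_prop)]
    · simp_rw [iSup_ofReal_min]
    · intro m n hmn ω
      dsimp only
      gcongr
  -- Only the negative part of `u (T ω)` has to be truncated: it stands on the smaller side, and
  -- monotone convergence recovers it.
  rw [hsup, ENNReal.add_iSup]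
  refine iSup_le fun n => ?_
  have hn := h _ (convexOn_max_zero (hu.add (convexOn_const (n : ℝ) convex_univ)))
    (fun x => le_max_right _ _)
  simp only [Pi.add_apply] at hn
  rw [← ENNReal.add_le_add_iff_right (ENNReal.natCast_ne_top n)]
  calc _ = (∫⁻ ω, ENNReal.ofReal (max (u (S ω)) 0) ∂P + n) +
        ∫⁻ ω, ENNReal.ofReal (min (max (-u (T ω)) 0) n) ∂P := by ring
    _ = ∫⁻ ω, ENNReal.ofReal (max (u (S ω) + n) 0) ∂P +
        ∫⁻ ω, ENNReal.ofReal (min (max (-u (S ω)) 0) n) ∂P +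
        ∫⁻ ω, ENNReal.ofReal (min (max (-u (T ω)) 0) n) ∂P := by rw [split S hS]
    _ ≤ ∫⁻ ω, ENNReal.ofReal (max (u (T ω) + n) 0) ∂P +
        ∫⁻ ω, ENNReal.ofReal (max (-u (S ω)) 0) ∂P +
        ∫⁻ ω, ENNReal.ofReal (min (max (-u (T ω)) 0) n) ∂P := by
      gcongr
      exact min_le_left _ _
    _ = (∫⁻ ω, ENNReal.ofReal (max (u (T ω) + n) 0) ∂P +
        ∫⁻ ω, ENNReal.ofReal (min (max (-u (T ω)) 0) n) ∂P) +
        ∫⁻ ω, ENNReal.ofReal (max (-u (S ω)) 0) ∂P := by ring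
    _ = _ := by rw [split T hT]; ring

/-- If `c = ⊤`, well-definedness makes `d` finite and the right side is `⊤`. Otherwise `a` is
finite, so `b = ⊤` makes the left side `⊥`, and in the remaining case all four are finite. -/
lemma ereal_sub_le_sub {a b c d : ENNReal} (h : a + d ≤ c + b) (hac : a ≤ c)
    (hcd : c < ⊤ ∨ d < ⊤) : (a : EReal) - (b : EReal) ≤ (c : EReal) - (d : EReal) := by
  by_cases hc : c = ⊤
  · have hd : d ≠ ⊤ := by
      rcases hcd with h' | h'
      · exact absurd hc h'.ne
      · exact h'.ne
    lift d to NNReal using hd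
    subst hc
    have : ((⊤ : ENNReal) : EReal) - ((d : ENNReal) : EReal) = ⊤ := EReal.top_sub_coe d
    rw [this]
    exact le_top
  have ha : a ≠ ⊤ := ne_top_of_le_ne_top hc hac
  by_cases hb : b = ⊤
  · subst hb
    have : (a : EReal) - ((⊤ : ENNReal) : EReal) = ⊥ := by simp
    rw [this]
    exact bot_le
  have hd : d ≠ ⊤ := fun hd => by simp [hd, hc, hb] at h
  lift a to NNReal using ha
  lift b to NNReal using hb
  lift c to NNReal using hc
  lift d to NNReal using hd
  have h' : (a : ℝ) + d ≤ c + b := by exact_mod_cast h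
  have : (((a : ℝ) - b : ℝ) : EReal) ≤ (((c : ℝ) - d : ℝ) : EReal) :=
    EReal.coe_le_coe_iff.2 (by linarith)
  exact this

lemma NonnegConvexLE.convexLE [IsProbabilityMeasure P] {S T : Ω → ℝ} (hS : Measurable S)
    (hT : Measurable T) (h : NonnegConvexLE P S T) : ConvexLE P S T := fun _ hu _ hTw =>
  ereal_sub_le_sub (h.lintegral_add_le hS hT hu)
    (h _ (convexOn_max_zero hu) fun _ => le_max_right _ _) hTw

/-! ### Convex functions as mixtures of stop-loss functions -/

/-- Fundamental theorem of calculus for a convex function to the right of a zero minimum. -/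
lemma ofReal_eq_lintegral_rightDeriv {u : ℝ → ℝ} (hu : ConvexOn ℝ univ u) (h0 : ∀ x, 0 ≤ u x)
    {m : ℝ} (hm : u m = 0) (x : ℝ) :
    ENNReal.ofReal (u (max x m)) =
      ∫⁻ t in Ioo m x, ENNReal.ofReal (derivWithin u (Ioi t) t) := by
  rcases le_total x m with hx | hx
  · simp [hx, hm]
  have hmono : Monotone (fun t => derivWithin u (Ioi t) t) := by
    simpa [monotoneOn_univ] using hu.monotoneOn_rightDeriv
  have hint : IntervalIntegrable (fun t => derivWithin u (Ioi t) t) volume m x :=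
    hmono.intervalIntegrable
  have hftc := intervalIntegral.integral_eq_sub_of_hasDeriv_right_of_le hx
    (continuous_of_convexOn_univ hu).continuousOn
    (fun t _ => hu.hasDerivWithinAt_rightDeriv_of_mem_interior (by simp)) hint
  rw [max_eq_left hx]
  have hux : u x = ∫ t in Ioo m x, derivWithin u (Ioi t) t := by
    rw [← integral_Ioc_eq_integral_Ioo, ← intervalIntegral.integral_of_le hx, hftc, hm, sub_zero]
  rw [hux, ofReal_integral_eq_lintegral_ofReal
    (((intervalIntegrable_iff_integrableOn_Ioc_of_le hx).1 hint).mono_set Ioo_subset_Ioc_self)]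
  refine (ae_restrict_iff' measurableSet_Ioo).2 (.of_forall fun t ht => ?_)
  -- To the right of the zero `m` the right derivative dominates the slope from `m`, which is
  -- nonnegative.
  have h1 := hu.slope_le_leftDeriv_of_mem_interior (mem_univ m) (by simp) ht.1
  have h2 := hu.leftDeriv_le_rightDeriv_of_mem_interior (x := t) (by simp)
  have h3 : 0 ≤ slope u m t := by
    rw [slope_def_field, hm, sub_zero]
    exact div_nonneg (h0 t) (sub_nonneg.2 ht.1.le)
  exact h3.trans (h1.trans h2)

/-- A convex function to the right of a zero minimum is a mixture of stop-loss functions, whose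
retentions are the level points of the right derivative. -/
lemma ofReal_eq_lintegral_volume {u : ℝ → ℝ} (hu : ConvexOn ℝ univ u) (h0 : ∀ x, 0 ≤ u x)
    {m : ℝ} (hm : u m = 0) (x : ℝ) :
    ENNReal.ofReal (u (max x m)) =
      ∫⁻ s in Ioi (0 : ℝ), volume {t | t < x ∧ m < t ∧ s < derivWithin u (Ioi t) t} := by
  have hmono : Monotone (fun t => derivWithin u (Ioi t) t) := by
    simpa [monotoneOn_univ] using hu.monotoneOn_rightDeriv
  have hd := hmono.measurable
  have hset : MeasurableSet {p : ℝ × ℝ | p.2 < derivWithin u (Ioi p.1) p.1} :=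
    measurableSet_lt measurable_snd (hd.comp measurable_fst)
  have hlevel : ∀ t, ENNReal.ofReal (derivWithin u (Ioi t) t) =
      ∫⁻ s in Ioi (0 : ℝ),
        {p : ℝ × ℝ | p.2 < derivWithin u (Ioi p.1) p.1}.indicator 1 (t, s) := by
    intro t
    have : (fun s => {p : ℝ × ℝ | p.2 < derivWithin u (Ioi p.1) p.1}.indicator
        (1 : ℝ × ℝ → ENNReal) (t, s)) = (Iio (derivWithin u (Ioi t) t)).indicator 1 := by
      ext s
      simp [indicator_apply]
    rw [this, lintegral_indicator_one measurableSet_Iio, Measure.restrict_apply measurableSet_Iio,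
      inter_comm, Ioi_inter_Iio, Real.volume_Ioo, sub_zero]
  rw [ofReal_eq_lintegral_rightDeriv hu h0 hm]
  simp_rw [hlevel]
  rw [lintegral_lintegral_swap
    (f := fun t s => {p : ℝ × ℝ | p.2 < derivWithin u (Ioi p.1) p.1}.indicator 1 (t, s))
    ((measurable_one.indicator hset).aemeasurable)]
  refine lintegral_congr fun s => ?_
  have : (fun t => {p : ℝ × ℝ | p.2 < derivWithin u (Ioi p.1) p.1}.indicator
      (1 : ℝ × ℝ → ENNReal) (t, s)) = {t | s < derivWithin u (Ioi t) t}.indicator 1 := by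
    ext t
    simp [indicator_apply]
  have hms : MeasurableSet {t | s < derivWithin u (Ioi t) t} := measurableSet_lt measurable_const hd
  rw [this, lintegral_indicator_one hms, Measure.restrict_apply hms]
  congr 1
  ext t
  simp only [mem_inter_iff, mem_ofPred_eq, mem_Ioo]
  tauto

/-- A nonempty upper set bounded below is a half-line starting at its infimum `k`; whether it
contains `k` does not affect the volume. -/
lemma volume_lt_inter_upperSet {A : Set ℝ} (hA : IsUpperSet A) (hb : BddBelow A) :
    (∀ x, volume {t | t < x ∧ t ∈ A} = 0) ∨
      ∃ k, ∀ x, volume {t | t < x ∧ t ∈ A} = ENNReal.ofReal (x - k) := by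
  rcases A.eq_empty_or_nonempty with rfl | hne
  · left
    simp
  refine Or.inr ⟨sInf A, fun x => le_antisymm ?_ ?_⟩
  · rw [← Real.volume_Ico]
    exact measure_mono fun t ht => ⟨csInf_le hb ht.2, ht.1⟩
  · rw [← Real.volume_Ioo]
    refine measure_mono fun t ht => ⟨ht.2, ?_⟩
    obtain ⟨a, ha, hat⟩ := exists_lt_of_csInf_lt hne ht.1
    exact hA hat.le ha

/-- By Tonelli the levels `s` of the right derivative can be treated one at a time. Each superlevel
set is an upper set since the derivative is monotone, so it contributes nothing or a single
stop-loss transform. -/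
lemma lintegral_right_le [IsProbabilityMeasure P] {S T : Ω → ℝ} (hS : Measurable S)
    (hT : Measurable T)
    (h : ∀ k, ∫⁻ ω, ENNReal.ofReal (S ω - k) ∂P ≤ ∫⁻ ω, ENNReal.ofReal (T ω - k) ∂P)
    {u : ℝ → ℝ} (hu : ConvexOn ℝ univ u) (h0 : ∀ x, 0 ≤ u x) {m : ℝ} (hm : u m = 0) :
    ∫⁻ ω, ENNReal.ofReal (u (max (S ω) m)) ∂P ≤ ∫⁻ ω, ENNReal.ofReal (u (max (T ω) m)) ∂P := by
  have hmono : Monotone (fun t => derivWithin u (Ioi t) t) := by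
    simpa [monotoneOn_univ] using hu.monotoneOn_rightDeriv
  have hd := hmono.measurable
  have hmeas : Measurable (fun p : ℝ × ℝ =>
      volume {t | t < p.1 ∧ m < t ∧ p.2 < derivWithin u (Ioi t) t}) := by
    have hs : MeasurableSet {q : (ℝ × ℝ) × ℝ |
        q.2 < q.1.1 ∧ m < q.2 ∧ q.1.2 < derivWithin u (Ioi q.2) q.2} :=
      (measurableSet_lt measurable_snd (measurable_fst.comp measurable_fst)).inter
        ((measurableSet_lt measurable_const measurable_snd).inter
          (measurableSet_lt (measurable_snd.comp measurable_fst) (hd.comp measurable_snd)))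
    exact measurable_measure_prodMk_left hs
  have swap : ∀ V : Ω → ℝ, Measurable V → ∫⁻ ω, ENNReal.ofReal (u (max (V ω) m)) ∂P =
      ∫⁻ s in Ioi (0 : ℝ), ∫⁻ ω,
        volume {t | t < V ω ∧ m < t ∧ s < derivWithin u (Ioi t) t} ∂P := by
    intro V hV
    simp_rw [ofReal_eq_lintegral_volume hu h0 hm]
    exact lintegral_lintegral_swap
      (hmeas.comp ((hV.comp measurable_fst).prodMk measurable_snd)).aemeasurable
  rw [swap S hS, swap T hT]
  refine lintegral_mono fun s => ?_
  have hup : IsUpperSet {t | m < t ∧ s < derivWithin u (Ioi t) t} :=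
    fun a b hab ha => ⟨ha.1.trans_le hab, ha.2.trans_le (hmono hab)⟩
  have hbd : BddBelow {t | m < t ∧ s < derivWithin u (Ioi t) t} := ⟨m, fun t ht => ht.1.le⟩
  rcases volume_lt_inter_upperSet hup hbd with hv | ⟨k, hv⟩
  · simp only [mem_ofPred_eq] at hv
    simp [hv]
  · simp only [mem_ofPred_eq] at hv
    simpa [hv] using h k

/-- Nonnegative convex test functions are controlled by upper and lower stop-loss transforms. -/
lemma nonnegConvexLE_of_stopLoss [IsProbabilityMeasure P] {S T : Ω → ℝ} (hS : Measurable S)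
    (hT : Measurable T)
    (h : ∀ k, ∫⁻ ω, ENNReal.ofReal (S ω - k) ∂P ≤ ∫⁻ ω, ENNReal.ofReal (T ω - k) ∂P)
    (h' : ∀ k, ∫⁻ ω, ENNReal.ofReal (-S ω - k) ∂P ≤ ∫⁻ ω, ENNReal.ofReal (-T ω - k) ∂P) :
    NonnegConvexLE P S T := by
  have zero_min : ∀ u : ℝ → ℝ, ConvexOn ℝ univ u → (∀ x, 0 ≤ u x) → ∀ m, u m = 0 →
      ∫⁻ ω, ENNReal.ofReal (u (S ω)) ∂P ≤ ∫⁻ ω, ENNReal.ofReal (u (T ω)) ∂P := by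
    intro u hu h0 m hm
    have hum : Measurable u := (continuous_of_convexOn_univ hu).measurable
    -- Cut `u` at its zero `m`; the left half is the right half of `x ↦ u (-x)` at `-m`.
    have hsum : ∀ x, ENNReal.ofReal (u x) =
        ENNReal.ofReal (u (max x m)) + ENNReal.ofReal (u (-max (-x) (-m))) := by
      intro x
      rcases le_total x m with hx | hx
      · rw [max_eq_right hx, max_eq_left (neg_le_neg hx), neg_neg, hm, ENNReal.ofReal_zero, zero_add]
      · rw [max_eq_left hx, max_eq_right (neg_le_neg hx), neg_neg, hm, ENNReal.ofReal_zero, add_zero]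
    rw [lintegral_congr fun ω => hsum (S ω), lintegral_congr fun ω => hsum (T ω)]
    rw [lintegral_add_left (by fun_prop), lintegral_add_left (by fun_prop)]
    exact add_le_add (lintegral_right_le hS hT h hu h0 hm)
      (lintegral_right_le hS.neg hT.neg h' (convexOn_comp_neg hu) (fun x => h0 (-x))
        (m := -m) (by simpa using hm))
  intro u hu h0
  have hbdd : BddBelow (range u) := ⟨0, by rintro _ ⟨x, rfl⟩; exact h0 x⟩
  set c := sInf (range u) with hc
  have hc0 : 0 ≤ c := le_csInf (range_nonempty u) (by rintro _ ⟨x, rfl⟩; exact h0 x)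
  have hcu : ∀ x, c ≤ u x := fun x => csInf_le hbdd (mem_range_self x)
  -- The infimum `c` need not be attained, as for `exp`. Cutting at `c + ε` produces a zero, and
  -- `max u (c + ε)` lies between `u` and `u + ε`.
  refine ENNReal.le_of_forall_pos_le_add fun ε hε _ => ?_
  have hε' : (0 : ℝ) < ε := hε
  obtain ⟨_, ⟨m, rfl⟩, hm⟩ := exists_lt_of_csInf_lt (range_nonempty u) (lt_add_of_pos_right c hε')
  have hcut : ConvexOn ℝ univ (fun x => max (u x - (c + ε)) 0) :=
    convexOn_max_zero (hu.sub (concaveOn_const (c + (ε : ℝ)) convex_univ))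
  have key := zero_min _ hcut (fun x => le_max_right _ _) m (max_eq_right (by linarith))
  have hum : Measurable u := (continuous_of_convexOn_univ hu).measurable
  calc ∫⁻ ω, ENNReal.ofReal (u (S ω)) ∂P
      ≤ ∫⁻ ω, (ENNReal.ofReal (max (u (S ω) - (c + ε)) 0) + ENNReal.ofReal (c + ε)) ∂P := by
        refine lintegral_mono fun ω => ?_
        rw [← ENNReal.ofReal_add (le_max_right _ _) (by positivity)]
        exact ENNReal.ofReal_le_ofReal (by grind)
    _ = ∫⁻ ω, ENNReal.ofReal (max (u (S ω) - (c + ε)) 0) ∂P + ENNReal.ofReal (c + ε) := by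
        rw [lintegral_add_right _ measurable_const]
        simp
    _ ≤ ∫⁻ ω, ENNReal.ofReal (max (u (T ω) - (c + ε)) 0) ∂P + ENNReal.ofReal (c + ε) := by
        gcongr
    _ = ∫⁻ ω, (ENNReal.ofReal (max (u (T ω) - (c + ε)) 0) + ENNReal.ofReal (c + ε)) ∂P := by
        rw [lintegral_add_right _ measurable_const]
        simp
    _ ≤ ∫⁻ ω, (ENNReal.ofReal (u (T ω)) + ε) ∂P := by
        refine lintegral_mono fun ω => ?_
        rw [← ENNReal.ofReal_add (le_max_right _ _) (by positivity), ← ENNReal.ofReal_coe_nnreal,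
          ← ENNReal.ofReal_add (h0 _) (by positivity)]
        refine ENNReal.ofReal_le_ofReal ?_
        have := hcu (T ω)
        grind
    _ = ∫⁻ ω, ENNReal.ofReal (u (T ω)) ∂P + ε := by
        rw [lintegral_add_right _ measurable_const]
        simp

/-! ### Comonotonic sums -/

/-- A retention for the sum of two increasing functions splits into two retentions which both
functions pass at the same time. -/
lemma exists_retention_split {f g : ℝ → ℝ} (hf : Monotone f) (hg : Monotone g) (k : ℝ) :
    ∃ a, ∀ v, (f v ≤ a ∧ g v ≤ k - a) ∨ (a ≤ f v ∧ k - a ≤ g v) := by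
  -- The point `a` must lie between `f v` and `k - g v` for every `v`. Here `s` collects the lower
  -- and `t` the upper endpoints of these intervals. As `f` increases and `k - g` decreases, any two
  -- of the intervals meet, so a common point exists without any continuity.
  obtain ⟨a, hlow, hup⟩ := exists_between_of_forall_le
    (s := {x | ∃ v, (f v + g v ≤ k ∧ x = f v) ∨ (k < f v + g v ∧ x = k - g v)})
    (t := {x | ∃ v, (f v + g v ≤ k ∧ x = k - g v) ∨ (k < f v + g v ∧ x = f v)})
    (by
      rcases le_or_gt (f 0 + g 0) k with h | h
      · exact ⟨_, 0, Or.inl ⟨h, rfl⟩⟩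
      · exact ⟨_, 0, Or.inr ⟨h, rfl⟩⟩)
    (by
      rcases le_or_gt (f 0 + g 0) k with h | h
      · exact ⟨_, 0, Or.inl ⟨h, rfl⟩⟩
      · exact ⟨_, 0, Or.inr ⟨h, rfl⟩⟩)
    (by
      rintro _ ⟨v, hv⟩ _ ⟨w, hw⟩
      rcases le_total v w with hvw | hvw
      · have := hf hvw
        have := hg hvw
        rcases hv with ⟨_, rfl⟩ | ⟨_, rfl⟩ <;> rcases hw with ⟨_, rfl⟩ | ⟨_, rfl⟩ <;> linarith
      · have := hf hvw
        have := hg hvw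
        rcases hv with ⟨_, rfl⟩ | ⟨_, rfl⟩ <;> rcases hw with ⟨_, rfl⟩ | ⟨_, rfl⟩ <;> linarith)
  refine ⟨a, fun v => ?_⟩
  rcases le_or_gt (f v + g v) k with h | h
  · have h1 := hlow ⟨v, Or.inl ⟨h, rfl⟩⟩
    have h2 := hup ⟨v, Or.inl ⟨h, rfl⟩⟩
    exact Or.inl ⟨h1, by linarith⟩
  · have h1 := hlow ⟨v, Or.inr ⟨h, rfl⟩⟩
    have h2 := hup ⟨v, Or.inr ⟨h, rfl⟩⟩
    exact Or.inr ⟨h2, by linarith⟩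

lemma Comonotonic.neg {X Y : Ω → ℝ} (h : Comonotonic P X Y) :
    Comonotonic P (fun ω => -X ω) (fun ω => -Y ω) := by
  obtain ⟨V, f, g, hV, hf, hg, hX, hY⟩ := h
  refine ⟨fun ω => -V ω, fun x => -f (-x), fun x => -g (-x), hV.neg,
    fun a b hab => neg_le_neg (hf (neg_le_neg hab)),
    fun a b hab => neg_le_neg (hg (neg_le_neg hab)), ?_, ?_⟩
  · filter_upwards [hX] with ω h
    simp [h]
  · filter_upwards [hY] with ω h
    simp [h]

lemma ofReal_sub_le_add (x y k a : ℝ) :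
    ENNReal.ofReal (x + y - k) ≤ ENNReal.ofReal (x - a) + ENNReal.ofReal (y - (k - a)) := by
  refine le_of_eq_of_le ?_ ENNReal.ofReal_add_le
  congr 1
  ring

lemma stopLoss_add_le {X Y Z W Z' W' : Ω → ℝ} (hX : Measurable X) (hZ' : Measurable Z')
    (hXZ : NonnegConvexLE P X Z) (hYW : NonnegConvexLE P Y W) (hco : Comonotonic P Z' W')
    (hZZ' : IdentDistrib Z' Z P P) (hWW' : IdentDistrib W' W P P) (k : ℝ) :
    ∫⁻ ω, ENNReal.ofReal (X ω + Y ω - k) ∂P ≤ ∫⁻ ω, ENNReal.ofReal (Z' ω + W' ω - k) ∂P := by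
  obtain ⟨V, f, g, -, hf, hg, hfV, hgV⟩ := hco
  obtain ⟨a, ha⟩ := exists_retention_split hf hg k
  have eqZ : ∫⁻ ω, ENNReal.ofReal (Z' ω - a) ∂P = ∫⁻ ω, ENNReal.ofReal (Z ω - a) ∂P :=
    (hZZ'.comp (u := fun x => ENNReal.ofReal (x - a)) (by fun_prop)).lintegral_eq
  have eqW : ∫⁻ ω, ENNReal.ofReal (W' ω - (k - a)) ∂P =
      ∫⁻ ω, ENNReal.ofReal (W ω - (k - a)) ∂P :=
    (hWW'.comp (u := fun x => ENNReal.ofReal (x - (k - a))) (by fun_prop)).lintegral_eq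
  calc ∫⁻ ω, ENNReal.ofReal (X ω + Y ω - k) ∂P
      ≤ ∫⁻ ω, (ENNReal.ofReal (X ω - a) + ENNReal.ofReal (Y ω - (k - a))) ∂P :=
        lintegral_mono fun ω => ofReal_sub_le_add _ _ _ _
    _ = ∫⁻ ω, ENNReal.ofReal (X ω - a) ∂P + ∫⁻ ω, ENNReal.ofReal (Y ω - (k - a)) ∂P :=
        lintegral_add_left (by fun_prop) _
    _ ≤ ∫⁻ ω, ENNReal.ofReal (Z ω - a) ∂P + ∫⁻ ω, ENNReal.ofReal (W ω - (k - a)) ∂P :=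
        add_le_add (hXZ.stopLoss a) (hYW.stopLoss (k - a))
    _ = ∫⁻ ω, (ENNReal.ofReal (Z' ω - a) + ENNReal.ofReal (W' ω - (k - a))) ∂P := by
        rw [lintegral_add_left (by fun_prop), eqZ, eqW]
    _ = ∫⁻ ω, ENNReal.ofReal (Z' ω + W' ω - k) ∂P := by
        refine lintegral_congr_ae ?_
        filter_upwards [hfV, hgV] with ω h1 h2
        rw [h1, h2]
        -- The two excesses have the same sign, so taking positive parts is additive.
        rcases ha (V ω) with ⟨h3, h4⟩ | ⟨h3, h4⟩
        · rw [ENNReal.ofReal_of_nonpos (by linarith), ENNReal.ofReal_of_nonpos (by linarith),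
            ENNReal.ofReal_of_nonpos (by linarith), add_zero]
        · rw [← ENNReal.ofReal_add (by linarith) (by linarith)]
          congr 1
          ring

end ConvexOrder

theorem theorem4 {Ω : Type*} [MeasurableSpace Ω] (P : Measure Ω) [IsProbabilityMeasure P]
    (hP : ConvexOrder.Atomless P)
    (X Y Z W : Ω → ℝ) (hX : Measurable X) (hY : Measurable Y) (hZ : Measurable Z)
    (hW : Measurable W)
    (hXZ : ConvexOrder.ConvexLE P X Z) (hYW : ConvexOrder.ConvexLE P Y W)
    (Zco Wco : Ω → ℝ) (hco : ConvexOrder.IsComonotonicVersion P Zco Wco Z W) :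
    ConvexOrder.ConvexLE P (fun ω => X ω + Y ω) (fun ω => Zco ω + Wco ω) := by
  obtain ⟨hZm, hWm, hcom, hZd, hWd⟩ := hco
  refine ConvexOrder.NonnegConvexLE.convexLE (hX.add hY) (hZm.add hWm)
    (ConvexOrder.nonnegConvexLE_of_stopLoss (hX.add hY) (hZm.add hWm)
      (ConvexOrder.stopLoss_add_le hX hZm hXZ.nonnegConvexLE hYW.nonnegConvexLE hcom hZd hWd)
      fun k => ?_)
  -- The lower transforms come from negating everything, which preserves comonotonicity and the
  -- nonnegative convex order.
  have := ConvexOrder.stopLoss_add_le hX.neg hZm.neg hXZ.nonnegConvexLE.neg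
    hYW.nonnegConvexLE.neg hcom.neg (hZd.comp measurable_neg) (hWd.comp measurable_neg) k
  simpa [neg_add_rev, add_comm] using this
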